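/- Let $P\subseteq\mathbb{R}^2$ be a set of worker types $p=(p_c,p_m)$. A utility allocation assigns to each $p\in P$ a consumption utility $c(p)\in\mathbb{R}$ and a labor allocation $x(p)=(x_c(p),x_m(p))\in\mathbb{R}^2$. Suppose that it is incentive compatible, i.e. $c(p)-p_cx_c(p)-p_mx_m(p)\ \ge\ c(q)-p_cx_c(q)-p_mx_m(q)$ for all $p,q\in P$, and let $u(p)=c(p)-p_cx_c(p)-p_mx_m(p)$ be the indirect utility function. A worker $p\in P$ is called bunched if every neighborhood of $p$ contains two workers $p',p''\in P$, different from $p$ and from each other, with $x(p')=x(p'')$. Let $p\in P$, where either $p$ is an interior point of $P$ or $P$ is convex with non-empty interior, and suppose that $u$ is twice continuously differentiable on $P$ in a neighborhood of $p$ (at boundary points of $P$, derivatives are taken within $P$). Let $H(u)(q)$ denote the Hessian matrix of $u$ at $q$; $u$ is called strongly convex at $q$ if $H(u)(q)-\alpha I$ is positive semidefinite for some $\alpha>0$. Then: 1. If $u$ is strongly convex at $p$, then $p$ is not bunched; moreover $x$ (which equals $-\nabla u$ in the interior of $P$ near $p$) is injective on $N\cap P$ for some neighborhood $N$ of $p$.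 2. If there is a neighborhood of $p$ such that $u$ is not strongly convex at any point of $P$ in it, then $p$ is bunched. In particular, if $H(u)$ is degenerate (has zero determinant) at every point of $P$ in some neighborhood of $p$, then $p$ is bunched. -/

import Mathlib

open scoped Topology

/-- Vectors with a cognitive coordinate `0` and a manual coordinate `1`. -/
abbrev TaskVec : Type := EuclideanSpace ℝ (Fin 2)

/-- A utility allocation: to each worker type `p = (p_c, p_m)` it assigns the consumption utility
`c p` and the labor allocation `x p = (x_c p, x_m p)`. -/
structure Allocation where
  c : TaskVec → ℝ
  x : TaskVec → TaskVec

namespace Allocation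

/-- The utility `c(q) - p_c x_c(q) - p_m x_m(q)` of a worker of type `p` who reports type `q`. -/
def reportUtility (a : Allocation) (p q : TaskVec) : ℝ :=
  a.c q - p 0 * a.x q 0 - p 1 * a.x q 1

/-- The indirect utility function `u(p) = c(p) - p_c x_c(p) - p_m x_m(p)`. -/
def indirectUtility (a : Allocation) (p : TaskVec) : ℝ :=
  a.c p - p 0 * a.x p 0 - p 1 * a.x p 1

/-- Incentive compatibility on the type space `P`: no worker gains by misreporting. -/
def IncentiveCompatible (a : Allocation) (P : Set TaskVec) : Prop :=
  ∀ p ∈ P, ∀ q ∈ P, a.reportUtility p q ≤ a.reportUtility p p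

/-- The set of bunched workers in the type space `P`: every neighborhood of `p` contains two other
workers with identical labor allocations. -/
def bunchingSet (a : Allocation) (P : Set TaskVec) : Set TaskVec :=
  {p | p ∈ P ∧ ∀ N ∈ 𝓝 p, ∃ p' ∈ N ∩ P, ∃ p'' ∈ N ∩ P,
    p' ≠ p ∧ p'' ≠ p ∧ p' ≠ p'' ∧ a.x p' = a.x p''}

end Allocation

/-- The Hessian matrix at `p` of a function `u` on the type space `P`. At interior points of `P`
these are the usual second partial derivatives; at boundary points, derivatives within `P`. -/
noncomputable def hessianMatrix (u : TaskVec → ℝ) (P : Set TaskVec) (p : TaskVec) :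
    Matrix (Fin 2) (Fin 2) ℝ :=
  Matrix.of fun i j =>
    iteratedFDerivWithin ℝ 2 u P p ![EuclideanSpace.single i 1, EuclideanSpace.single j 1]

/-- `u` is strongly convex at `p`: `H(u) - α I` is positive semidefinite at `p`, for some
`α > 0`. -/
def StronglyConvexAt (u : TaskVec → ℝ) (P : Set TaskVec) (p : TaskVec) : Prop :=
  ∃ α : ℝ, 0 < α ∧ (hessianMatrix u P p - α • (1 : Matrix (Fin 2) (Fin 2) ℝ)).PosSemidef

/-! Incentive compatibility says exactly that `-x(q)` is a subgradient of `u` at `q`. If the Hessian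
is positive definite at `p`, continuity keeps it so nearby, `u` is strictly convex on a small convex
piece of `P`, and a strictly convex function has no common subgradient at two points: `x` is
injective there. Conversely, if `p` is not bunched, `x` is injective on some nonempty open `B ⊆ P`,
where `-x = ∇u` is `C¹`. Tilting `u` by linear functionals shows that `∇u(B)` contains a ball
(`ball_subset_image_of_injOn_subgradient`). By Sard's argument its image would be null if the
Hessian were singular throughout `B`, so it is nonsingular somewhere. Subgradients make it positive
semidefinite, hence positive definite at that point. The determinant criterion follows, since strong
convexity forces a positive determinant. -/

open Set MeasureTheory

/-! ### Convexity, subgradients and second derivatives in inner product spaces. -/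

section General

variable {E : Type*} [NormedAddCommGroup E] [InnerProductSpace ℝ E]

theorem strictConvexOn_of_fderivWithin_fderivWithin_pos {f : E → ℝ} {Q S : Set E}
    (hQ : UniqueDiffOn ℝ Q) (hf : ContDiffOn ℝ 2 f Q) (hS : Convex ℝ S) (hSQ : S ⊆ Q)
    (hpos : ∀ q ∈ S, ∀ v, v ≠ 0 → 0 < fderivWithin ℝ (fderivWithin ℝ f Q) Q q v v) :
    StrictConvexOn ℝ S f := by
  refine ⟨hS, fun q hq r hr hqr s t hs ht hst => ?_⟩
  -- Restriction to the segment reduces to one variable. Derivatives within `Q` suffice, so the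
  -- segment may lie in the boundary.
  set l : ℝ → E := fun τ => q + τ • (r - q) with hl
  have hv : r - q ≠ 0 := sub_ne_zero.2 hqr.symm
  have hlS : ∀ τ ∈ Icc (0 : ℝ) 1, l τ ∈ S := fun τ hτ => hS.add_smul_sub_mem hq hr hτ
  have hmaps : MapsTo l (Icc 0 1) Q := fun τ hτ => hSQ (hlS τ hτ)
  have hld : ∀ τ, HasDerivAt l (r - q) τ := fun τ => by
    have h : HasDerivAt (fun t : ℝ => t • (r - q)) (r - q) τ := by
      simpa using (hasDerivAt_id τ).smul_const (r - q)
    exact h.const_add q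
  have hdf : DifferentiableOn ℝ f Q := hf.differentiableOn (by norm_num)
  have hddf : DifferentiableOn ℝ (fderivWithin ℝ f Q) Q :=
    (hf.fderivWithin hQ (m := 1) (by norm_num)).differentiableOn (by norm_num)
  have hfl : ∀ τ ∈ Icc (0 : ℝ) 1,
      HasDerivWithinAt (fun τ => f (l τ)) (fderivWithin ℝ f Q (l τ) (r - q)) (Icc 0 1) τ :=
    fun τ hτ => (hdf _ (hmaps hτ)).hasFDerivWithinAt.comp_hasDerivWithinAt τ
      (hld τ).hasDerivWithinAt hmaps
  have hdfl : ∀ τ ∈ Icc (0 : ℝ) 1,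
      HasDerivWithinAt (fun τ => fderivWithin ℝ f Q (l τ) (r - q))
        (fderivWithin ℝ (fderivWithin ℝ f Q) Q (l τ) (r - q) (r - q)) (Icc 0 1) τ :=
    fun τ hτ => by
      have := (hddf _ (hmaps hτ)).hasFDerivWithinAt.comp_hasDerivWithinAt τ
        (hld τ).hasDerivWithinAt hmaps
      simpa using this.clm_apply (hasDerivWithinAt_const τ (Icc (0 : ℝ) 1) (r - q))
  have hmono : StrictMonoOn (fun τ => fderivWithin ℝ f Q (l τ) (r - q)) (Icc 0 1) := by
    refine strictMonoOn_of_deriv_pos (convex_Icc 0 1)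
      (fun τ hτ => (hdfl τ hτ).continuousWithinAt) fun τ hτ => ?_
    have hτ' := interior_subset hτ
    rw [((hdfl τ hτ').hasDerivAt (mem_interior_iff_mem_nhds.1 hτ)).deriv]
    exact hpos _ (hlS τ hτ') _ hv
  have hconv : StrictConvexOn ℝ (Icc 0 1) (fun τ => f (l τ)) := by
    refine StrictMonoOn.strictConvexOn_of_deriv (convex_Icc 0 1)
      (fun τ hτ => (hfl τ hτ).continuousWithinAt) ?_
    refine (hmono.mono interior_subset).congr fun τ hτ => ?_
    exact (((hfl τ (interior_subset hτ)).hasDerivAt (mem_interior_iff_mem_nhds.1 hτ)).deriv).symm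
  have key := hconv.2 (left_mem_Icc.2 zero_le_one) (right_mem_Icc.2 zero_le_one) zero_ne_one
    hs ht hst
  have hl1 : l (s • (0 : ℝ) + t • (1 : ℝ)) = s • q + t • r := by
    have : s = 1 - t := by linarith
    subst this
    simp only [hl, smul_eq_mul]
    module
  have hl0 : l 0 = q := by simp [hl]
  have hl1' : l 1 = r := by simp [hl]
  simpa only [hl1, hl0, hl1'] using key

theorem ContinuousWithinAt.eventually_norm_sub_lt {X F : Type*} [TopologicalSpace X]
    [SeminormedAddCommGroup F] {D : X → F} {s : Set X} {x : X} (h : ContinuousWithinAt D s x)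
    {ε : ℝ} (hε : 0 < ε) : ∀ᶠ y in 𝓝[s] x, ‖D y - D x‖ < ε := by
  simpa only [dist_eq_norm] using Metric.tendsto_nhds.1 h ε hε

theorem eventually_fderivWithin_fderivWithin_pos {f : E → ℝ} {Q : Set E}
    (hQ : UniqueDiffOn ℝ Q) (hf : ContDiffOn ℝ 2 f Q) {p : E} (hp : p ∈ Q) {α : ℝ} (hα : 0 < α)
    (hle : ∀ v, α * ‖v‖ ^ 2 ≤ fderivWithin ℝ (fderivWithin ℝ f Q) Q p v v) :
    ∀ᶠ q in 𝓝[Q] p, ∀ v, v ≠ 0 → 0 < fderivWithin ℝ (fderivWithin ℝ f Q) Q q v v := by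
  set D := fderivWithin ℝ (fderivWithin ℝ f Q) Q
  have hDc : ContinuousOn D Q :=
    (hf.fderivWithin hQ (m := 1) (by norm_num)).continuousOn_fderivWithin hQ (by norm_num)
  filter_upwards [ContinuousWithinAt.eventually_norm_sub_lt
    (F := E →L[ℝ] E →L[ℝ] ℝ) (hDc p hp) hα] with q h1 v hv
  have h2 := (abs_le.1 ((D q - D p).le_opNorm₂ v v)).1
  have h3 := hle v
  have hn : 0 < ‖v‖ := norm_pos_iff.2 hv
  simp only [sub_apply] at h2
  have h4 : ‖D q - D p‖ * ‖v‖ * ‖v‖ < α * ‖v‖ * ‖v‖ := by gcongr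
  nlinarith

theorem exists_pos_mul_norm_sq_le_of_injective [FiniteDimensional ℝ E]
    {L : E →L[ℝ] E →L[ℝ] ℝ} (hsymm : ∀ v w, L v w = L w v) (hnonneg : ∀ v, 0 ≤ L v v)
    (hinj : ∀ v, L v = 0 → v = 0) : ∃ α : ℝ, 0 < α ∧ ∀ v, α * ‖v‖ ^ 2 ≤ L v v := by
  have hpos : ∀ v, v ≠ 0 → 0 < L v v := by
    intro v hv
    refine (hnonneg v).lt_of_ne' fun h0 => hv (hinj v ?_)
    ext w
    simp only [zero_apply]
    -- Cauchy–Schwarz for a semidefinite form: with `L v v = 0` the quadratic `L (v + t w) (v + t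
    -- w)` has no constant term, so its discriminant bound forces `L v w = 0`.
    have hquad : ∀ t : ℝ, 0 ≤ L w w * (t * t) + (2 * L v w) * t + 0 := by
      intro t
      have := hnonneg (v + t • w)
      simp only [map_add, map_smul, add_apply,
        smul_apply, smul_eq_mul, h0, hsymm w v] at this
      linarith
    have := discrim_le_zero hquad
    simp only [discrim, mul_zero, sub_zero] at this
    nlinarith [sq_nonneg (L v w)]
  rcases (Metric.sphere (0 : E) 1).eq_empty_or_nonempty with he | hne
  · refine ⟨1, one_pos, fun v => ?_⟩
    by_cases hv : v = 0
    · simp [hv]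
    · have : (‖v‖⁻¹ • v) ∈ Metric.sphere (0 : E) 1 := by
        simp [norm_smul, hv]
      simp [he] at this
  · obtain ⟨w, hw, hmin⟩ := (isCompact_sphere (0 : E) 1).exists_isMinOn hne
      (f := fun v => L v v) (by fun_prop)
    have hw0 : w ≠ 0 := by
      rintro rfl
      simp at hw
    refine ⟨L w w, hpos w hw0, fun v => ?_⟩
    by_cases hv : v = 0
    · simp [hv]
    · have hmem : (‖v‖⁻¹ • v) ∈ Metric.sphere (0 : E) 1 := by
        simp [norm_smul, hv]
      have h1 : L w w ≤ L (‖v‖⁻¹ • v) (‖v‖⁻¹ • v) := hmin hmem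
      have hn : 0 < ‖v‖ := norm_pos_iff.2 hv
      simp only [map_smul, smul_apply, smul_eq_mul] at h1
      calc L w w * ‖v‖ ^ 2 ≤ (‖v‖⁻¹ * (‖v‖⁻¹ * L v v)) * ‖v‖ ^ 2 := by gcongr
        _ = L v v := by field_simp

theorem fderiv_eq_innerSL_of_subgradient {f : E → ℝ} {g : E → E} {B : Set E} (hB : IsOpen B)
    (hsub : ∀ q ∈ B, ∀ r ∈ B, f q + inner ℝ (g q) (r - q) ≤ f r) {q : E} (hq : q ∈ B)
    (hf : DifferentiableAt ℝ f q) : fderiv ℝ f q = innerSL ℝ (g q) := by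
  have hmin : IsLocalMin (fun r => f r - innerSL ℝ (g q) r) q := by
    filter_upwards [hB.mem_nhds hq] with r hr
    have := hsub q hq r hr
    rw [inner_sub_right] at this
    simp only [innerSL_apply_apply]
    linarith
  have h := hmin.hasFDerivAt_eq_zero
    (hf.hasFDerivAt.sub (innerSL ℝ (g q)).hasFDerivAt)
  exact sub_eq_zero.1 h

/-- Adding the subgradient inequalities at two points shows that the gradient is monotone, so its
difference quotients along `v`, paired with `v`, are nonnegative. -/
theorem fderiv_fderiv_nonneg_of_subgradient {f : E → ℝ} {g : E → E} {B : Set E} (hB : IsOpen B)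
    (hsub : ∀ q ∈ B, ∀ r ∈ B, f q + inner ℝ (g q) (r - q) ≤ f r) (hf : ContDiffOn ℝ 2 f B)
    {q : E} (hq : q ∈ B) (v : E) : 0 ≤ fderiv ℝ (fderiv ℝ f) q v v := by
  have hfd : ∀ r ∈ B, fderiv ℝ f r = innerSL ℝ (g r) := fun r hr =>
    fderiv_eq_innerSL_of_subgradient hB hsub hr
      ((hf.differentiableOn (by norm_num)).differentiableAt (hB.mem_nhds hr))
  have hd : DifferentiableAt ℝ (fderiv ℝ f) q :=
    ((hf.fderiv_of_isOpen hB (m := 1) (by norm_num)).differentiableOn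
      (by norm_num)).differentiableAt (hB.mem_nhds hq)
  set l : ℝ → E := fun t => q + t • v with hl
  have hld : HasDerivAt l v 0 := by
    have h : HasDerivAt (fun t : ℝ => t • v) v 0 := by
      simpa using (hasDerivAt_id (0 : ℝ)).smul_const v
    exact h.const_add q
  have hl0 : l 0 = q := by simp [hl]
  have hd0 : HasFDerivAt (fderiv ℝ f) (fderiv ℝ (fderiv ℝ f) q) (l 0) := by
    rw [hl0]; exact hd.hasFDerivAt
  have hder : HasDerivAt (fun t => fderiv ℝ f (l t) v) (fderiv ℝ (fderiv ℝ f) q v v) 0 := by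
    simpa using (hd0.comp_hasDerivAt (0 : ℝ) hld).clm_apply (hasDerivAt_const (0 : ℝ) v)
  have hslope := hder.tendsto_slope_zero_right
  refine ge_of_tendsto hslope ?_
  have hlB : ∀ᶠ t in 𝓝[>] (0 : ℝ), l t ∈ B :=
    (hld.continuousAt.eventually_mem (by rw [hl0]; exact hB.mem_nhds hq)).filter_mono
      nhdsWithin_le_nhds
  filter_upwards [hlB, self_mem_nhdsWithin] with t ht ht0
  have ht0' : 0 < t := ht0
  simp only [zero_add, hl0, smul_eq_mul]
  refine mul_nonneg (inv_nonneg.2 ht0'.le) ?_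
  rw [hfd _ ht, hfd _ hq]
  have h1 := hsub q hq _ ht
  have h2 := hsub _ ht q hq
  have e1 : l t - q = t • v := by simp [hl]
  have e2 : q - l t = -(t • v) := by simp [hl]
  rw [e1, inner_smul_right] at h1
  rw [e2, inner_neg_right, inner_smul_right] at h2
  simp only [innerSL_apply_apply]
  nlinarith

/-- An injective selection of subgradients of a differentiable function has open image. -/
theorem ball_subset_image_of_injOn_subgradient [FiniteDimensional ℝ E] {f : E → ℝ} {g : E → E}
    {B : Set E} (hB : IsOpen B)
    (hsub : ∀ q ∈ B, ∀ r ∈ B, f q + inner ℝ (g q) (r - q) ≤ f r) (hf : DifferentiableOn ℝ f B)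
    (hg : InjOn g B) {q : E} (hq : q ∈ B) : ∃ ε > 0, Metric.ball (g q) ε ⊆ g '' B := by
  have hfd : ∀ r ∈ B, fderiv ℝ f r = innerSL ℝ (g r) := fun r hr =>
    fderiv_eq_innerSL_of_subgradient hB hsub hr (hf.differentiableAt (hB.mem_nhds hr))
  have hcrit : ∀ r ∈ B, ∀ s : E, IsLocalMin (fun t => f t - innerSL ℝ s t) r → g r = s := by
    intro r hr s hmin
    have h := hmin.hasFDerivAt_eq_zero
      ((hf.differentiableAt (hB.mem_nhds hr)).hasFDerivAt.sub (innerSL ℝ s).hasFDerivAt)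
    rw [hfd r hr, sub_eq_zero] at h
    exact (innerSL_inj (𝕜 := ℝ)).1 h
  -- Equality at `r` would make `r` another minimizer of `f - ⟪g q, ·⟫`, giving `g r = g q` against
  -- injectivity.
  have hstrict : ∀ r ∈ B, r ≠ q → f q + inner ℝ (g q) (r - q) < f r := by
    intro r hr hrq
    refine (hsub q hq r hr).lt_of_ne fun heq => hrq (hg hr hq (hcrit r hr (g q) ?_))
    filter_upwards [hB.mem_nhds hr] with t ht
    have := hsub q hq t ht
    rw [inner_sub_right] at this heq
    simp only [innerSL_apply_apply]
    linarith
  obtain ⟨ρ, hρ, hρB⟩ := Metric.nhds_basis_closedBall.mem_iff.1 (hB.mem_nhds hq)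
  have hgap : ∃ δ > 0, ∀ r ∈ Metric.sphere q ρ, f q + inner ℝ (g q) (r - q) + δ ≤ f r := by
    rcases (Metric.sphere q ρ).eq_empty_or_nonempty with he | hne
    · exact ⟨1, one_pos, by simp [he]⟩
    · have hcont : ContinuousOn (fun r => f r - inner ℝ (g q) (r - q)) (Metric.sphere q ρ) := by
        refine ContinuousOn.sub (hf.continuousOn.mono
          (Metric.sphere_subset_closedBall.trans hρB)) (by fun_prop)
      obtain ⟨w, hw, hmin⟩ := (isCompact_sphere q ρ).exists_isMinOn hne hcont
      have hwq : w ≠ q := Metric.ne_of_mem_sphere hw hρ.ne'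
      have hws := hstrict w (hρB (Metric.sphere_subset_closedBall hw)) hwq
      refine ⟨f w - inner ℝ (g q) (w - q) - f q, by linarith, fun r hr => ?_⟩
      have : f w - inner ℝ (g q) (w - q) ≤ f r - inner ℝ (g q) (r - q) := hmin hr
      linarith
  obtain ⟨δ, hδ, hgap⟩ := hgap
  -- Replacing `g q` by `s` changes the tilt on the sphere by less than `δ`, so the minimum over the
  -- closed ball stays in the interior.
  refine ⟨δ / ρ, by positivity, fun s hs => ?_⟩
  obtain ⟨w, hw, hmin⟩ := (isCompact_closedBall q ρ).exists_isMinOn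
    ⟨q, Metric.mem_closedBall_self hρ.le⟩ (f := fun t => f t - innerSL ℝ s t)
    ((hf.continuousOn.mono hρB).sub (by fun_prop))
  have hwball : w ∈ Metric.ball q ρ := by
    by_contra hnot
    have hws : w ∈ Metric.sphere q ρ := by
      rw [Metric.mem_sphere]
      exact le_antisymm hw (not_lt.1 hnot)
    have h1 := hgap w hws
    have h2 : f w - inner ℝ s w ≤ f q - inner ℝ s q := hmin (Metric.mem_closedBall_self hρ.le)
    have h3 : inner ℝ (s - g q) (w - q) ≤ ‖s - g q‖ * ‖w - q‖ := real_inner_le_norm _ _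
    rw [mem_sphere_iff_norm.1 hws] at h3
    have h4 : ‖s - g q‖ * ρ < δ := (lt_div_iff₀ hρ).1 (mem_ball_iff_norm.1 hs)
    simp only [inner_sub_left, inner_sub_right] at h1 h3
    linarith
  have hwB : w ∈ B := hρB hw
  exact ⟨w, hwB, hcrit w hwB s (hmin.isLocalMin
    (Filter.mem_of_superset (Metric.isOpen_ball.mem_nhds hwball) Metric.ball_subset_closedBall))⟩

theorem exists_fderiv_fderiv_injective_of_injOn_subgradient [FiniteDimensional ℝ E]
    {f : E → ℝ} {g : E → E} {B : Set E} (hB : IsOpen B) (hne : B.Nonempty)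
    (hsub : ∀ q ∈ B, ∀ r ∈ B, f q + inner ℝ (g q) (r - q) ≤ f r) (hf : ContDiffOn ℝ 2 f B)
    (hg : InjOn g B) : ∃ q ∈ B, ∀ v, fderiv ℝ (fderiv ℝ f) q v = 0 → v = 0 := by
  borelize E
  by_contra! hcon
  have hdf : DifferentiableOn ℝ f B := hf.differentiableOn (by norm_num)
  -- The inverse Riesz map turns the second derivative into an endomorphism of `E`, which has a
  -- determinant.
  let J : StrongDual ℝ E →L[ℝ] E := LinearMap.toContinuousLinearMap
    { toFun := (InnerProductSpace.toDual ℝ E).symm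
      map_add' := map_add _
      map_smul' := fun c φ => by simp }
  have hJ : ∀ φ, J φ = (InnerProductSpace.toDual ℝ E).symm φ := fun φ => rfl
  have hgJ : EqOn g (fun r => J (fderiv ℝ f r)) B := by
    intro r hr
    have h := fderiv_eq_innerSL_of_subgradient hB hsub hr (hdf.differentiableAt (hB.mem_nhds hr))
    change g r = (InnerProductSpace.toDual ℝ E).symm (fderiv ℝ f r)
    rw [h, LinearIsometryEquiv.eq_symm_apply]
    ext w
    simp
  have hgd : ∀ r ∈ B, HasFDerivWithinAt g (J.comp (fderiv ℝ (fderiv ℝ f) r)) B r := by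
    intro r hr
    have hd : DifferentiableAt ℝ (fderiv ℝ f) r :=
      ((hf.fderiv_of_isOpen hB (m := 1) (by norm_num)).differentiableOn
        (by norm_num)).differentiableAt (hB.mem_nhds hr)
    exact ((J.hasFDerivAt.comp r hd.hasFDerivAt).hasFDerivWithinAt).congr hgJ (hgJ hr)
  have hdet : ∀ r ∈ B, (J.comp (fderiv ℝ (fderiv ℝ f) r)).det = 0 := by
    intro r hr
    obtain ⟨v, hv0, hv⟩ := hcon r hr
    refine LinearMap.det_eq_zero_iff_ker_ne_bot.2 fun hbot => hv ?_
    have : v ∈ LinearMap.ker (J.comp (fderiv ℝ (fderiv ℝ f) r) : E →ₗ[ℝ] E) := by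
      simp [hv0]
    rw [hbot] at this
    exact (Submodule.mem_bot ℝ).1 this
  have hzero := addHaar_image_eq_zero_of_det_fderivWithin_eq_zero (Measure.addHaar) hgd hdet
  obtain ⟨q, hq⟩ := hne
  obtain ⟨ε, hε, hball⟩ := ball_subset_image_of_injOn_subgradient hB hsub hdf hg hq
  exact (Metric.measure_ball_pos Measure.addHaar (g q) hε).ne' (measure_mono_null hball hzero)

end General

/-! ### The Hessian matrix as a bilinear form, and localization of the type space. -/

section Hessian

variable {u : TaskVec → ℝ} {P : Set TaskVec}

theorem dotProduct_hessianMatrix_mulVec {q : TaskVec} (hP : UniqueDiffOn ℝ P) (hq : q ∈ P)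
    (v : Fin 2 → ℝ) :
    v ⬝ᵥ (hessianMatrix u P q).mulVec v =
      fderivWithin ℝ (fderivWithin ℝ u P) P q (WithLp.toLp 2 v) (WithLp.toLp 2 v) := by
  have hv : WithLp.toLp 2 v = v 0 • EuclideanSpace.single (0 : Fin 2) (1 : ℝ) +
      v 1 • EuclideanSpace.single (1 : Fin 2) (1 : ℝ) := by
    ext i
    fin_cases i <;> simp
  rw [hv]
  simp only [hessianMatrix, iteratedFDerivWithin_two_apply' u hP hq, dotProduct, Matrix.mulVec,
    Fin.sum_univ_two, Matrix.of_apply, map_add, map_smul, add_apply,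
    smul_apply, smul_eq_mul]
  ring

theorem StronglyConvexAt.exists_pos_mul_norm_sq_le {q : TaskVec} (hP : UniqueDiffOn ℝ P)
    (hq : q ∈ P) (h : StronglyConvexAt u P q) :
    ∃ α : ℝ, 0 < α ∧ ∀ v, α * ‖v‖ ^ 2 ≤ fderivWithin ℝ (fderivWithin ℝ u P) P q v v := by
  obtain ⟨α, hα, hpsd⟩ := h
  refine ⟨α, hα, fun v => ?_⟩
  have h := hpsd.dotProduct_mulVec_nonneg v.ofLp
  rw [star_trivial, Matrix.sub_mulVec, dotProduct_sub, dotProduct_hessianMatrix_mulVec hP hq,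
    Matrix.smul_mulVec, Matrix.one_mulVec, dotProduct_smul, smul_eq_mul] at h
  rw [EuclideanSpace.real_norm_sq_eq]
  simp only [dotProduct, ← pow_two] at h
  simpa using h

theorem StronglyConvexAt.det_hessianMatrix_pos {q : TaskVec} (h : StronglyConvexAt u P q) :
    0 < (hessianMatrix u P q).det := by
  obtain ⟨α, hα, hpsd⟩ := h
  -- The Hessian is `(H - αI) + αI`, semidefinite plus definite.
  have := (Matrix.PosDef.posSemidef_add hpsd (Matrix.PosDef.one.smul hα)).det_pos
  simpa using this

theorem stronglyConvexAt_of_mul_norm_sq_le {q : TaskVec} (hP : UniqueDiffOn ℝ P) (hq : q ∈ P)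
    (hsymm : ∀ v w, fderivWithin ℝ (fderivWithin ℝ u P) P q v w =
      fderivWithin ℝ (fderivWithin ℝ u P) P q w v) {α : ℝ} (hα : 0 < α)
    (h : ∀ v, α * ‖v‖ ^ 2 ≤ fderivWithin ℝ (fderivWithin ℝ u P) P q v v) :
    StronglyConvexAt u P q := by
  refine ⟨α, hα, Matrix.PosSemidef.of_dotProduct_mulVec_nonneg ?_ fun v => ?_⟩
  · refine Matrix.IsHermitian.sub ?_ (by simp [Matrix.IsHermitian])
    ext i j
    simp [hessianMatrix, iteratedFDerivWithin_two_apply' u hP hq, hsymm]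
  · rw [star_trivial, Matrix.sub_mulVec, dotProduct_sub, dotProduct_hessianMatrix_mulVec hP hq,
      Matrix.smul_mulVec, Matrix.one_mulVec, dotProduct_smul, smul_eq_mul]
    have := h (WithLp.toLp 2 v)
    rw [EuclideanSpace.real_norm_sq_eq] at this
    simp only [dotProduct, ← pow_two]
    simpa using this

theorem hessianMatrix_inter_open {U : Set TaskVec} (hU : IsOpen U) {q : TaskVec} (hq : q ∈ U) :
    hessianMatrix u (P ∩ U) q = hessianMatrix u P q := by
  simp only [hessianMatrix, iteratedFDerivWithin_inter_open hU hq]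

theorem stronglyConvexAt_inter_open_iff {U : Set TaskVec} (hU : IsOpen U) {q : TaskVec}
    (hq : q ∈ U) : StronglyConvexAt u (P ∩ U) q ↔ StronglyConvexAt u P q := by
  simp only [StronglyConvexAt, hessianMatrix_inter_open hU hq]

/-- Near `p` the type space may be replaced by a convex one on which `u` is `C²`. -/
theorem exists_ball_inter_convex_contDiffOn {p : TaskVec} (hp : p ∈ P)
    (hP : p ∈ interior P ∨ (Convex ℝ P ∧ (interior P).Nonempty))
    (hu : ContDiffWithinAt ℝ 2 u P p) :
    ∃ ρ > 0, Convex ℝ (P ∩ Metric.ball p ρ) ∧ ContDiffOn ℝ 2 u (P ∩ Metric.ball p ρ) ∧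
      p ∈ closure (interior P) := by
  obtain ⟨W, hW, hpW, hcd⟩ := hu.contDiffOn' le_rfl (by simp)
  rw [insert_eq_of_mem hp] at hcd
  rcases hP with hint | ⟨hconv, hne⟩
  · obtain ⟨ρ, hρ, hsub⟩ := Metric.isOpen_iff.1 (hW.inter isOpen_interior) p ⟨hpW, hint⟩
    refine ⟨ρ, hρ, ?_, hcd.mono (inter_subset_inter_right _ fun y hy => (hsub hy).1),
      subset_closure hint⟩
    rw [inter_eq_self_of_subset_right fun y hy => interior_subset (hsub hy).2]
    exact convex_ball p ρ
  · obtain ⟨ρ, hρ, hsub⟩ := Metric.isOpen_iff.1 hW p hpW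
    refine ⟨ρ, hρ, hconv.inter (convex_ball p ρ), hcd.mono (inter_subset_inter_right _ hsub), ?_⟩
    rw [hconv.closure_interior_eq_closure_of_nonempty_interior hne]
    exact subset_closure hp

end Hessian

/-! ### Consequences of incentive compatibility. -/

namespace Allocation

variable {a : Allocation} {P : Set TaskVec}

theorem IncentiveCompatible.subgradient (ha : a.IncentiveCompatible P) {q r : TaskVec}
    (hq : q ∈ P) (hr : r ∈ P) :
    a.indirectUtility q + inner ℝ (-a.x q) (r - q) ≤ a.indirectUtility r := by
  have h := ha r hr q hq
  simp only [reportUtility] at h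
  simp only [indirectUtility, inner_neg_left, PiLp.inner_apply, Fin.sum_univ_two,
    RCLike.inner_apply, conj_trivial, PiLp.sub_apply]
  linarith

theorem IncentiveCompatible.injOn_of_strictConvexOn (ha : a.IncentiveCompatible P)
    {S : Set TaskVec} (hSP : S ⊆ P) (hS : StrictConvexOn ℝ S a.indirectUtility) :
    InjOn a.x S := by
  intro q hq r hr hx
  by_contra hqr
  -- At the midpoint, the linear terms of the two subgradient bounds cancel when `x q = x r`; their
  -- average contradicts strict convexity.
  have hhalf : (0 : ℝ) < 1 / 2 := by norm_num
  have hm := hS.1 hq hr hhalf.le hhalf.le (add_halves 1)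
  have h0 := hS.2 hq hr hqr hhalf hhalf (add_halves 1)
  have h1 := ha.subgradient (hSP hq) (hSP hm)
  have h2 := ha.subgradient (hSP hr) (hSP hm)
  have e1 : (1 / 2 : ℝ) • q + (1 / 2 : ℝ) • r - q = (1 / 2 : ℝ) • (r - q) := by module
  have e2 : (1 / 2 : ℝ) • q + (1 / 2 : ℝ) • r - r = -((1 / 2 : ℝ) • (r - q)) := by module
  rw [e1] at h1
  rw [e2, inner_neg_right, ← hx] at h2
  simp only [smul_eq_mul] at h0
  linarith

theorem not_mem_bunchingSet_of_injOn {p : TaskVec} {N : Set TaskVec} (hN : N ∈ 𝓝 p)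
    (hinj : InjOn a.x (N ∩ P)) : p ∉ a.bunchingSet P := by
  rintro ⟨-, h⟩
  obtain ⟨p', hp', p'', hp'', -, -, hne, hx⟩ := h N hN
  exact hne (hinj hp' hp'' hx)

theorem IncentiveCompatible.exists_stronglyConvexAt_of_injOn (ha : a.IncentiveCompatible P)
    {B : Set TaskVec} (hB : IsOpen B) (hne : B.Nonempty) (hBP : B ⊆ P)
    (hu : ContDiffOn ℝ 2 a.indirectUtility B) (hinj : InjOn a.x B) :
    ∃ q ∈ B, StronglyConvexAt a.indirectUtility P q := by
  have hsub : ∀ q ∈ B, ∀ r ∈ B,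
      a.indirectUtility q + inner ℝ (-a.x q) (r - q) ≤ a.indirectUtility r :=
    fun q hq r hr => ha.subgradient (hBP hq) (hBP hr)
  obtain ⟨q, hq, hker⟩ := exists_fderiv_fderiv_injective_of_injOn_subgradient hB hne hsub hu
    (fun q hq r hr h => hinj hq hr (neg_injective h))
  have hsymm : ∀ v w, fderiv ℝ (fderiv ℝ a.indirectUtility) q v w =
      fderiv ℝ (fderiv ℝ a.indirectUtility) q w v :=
    (hu.contDiffAt (hB.mem_nhds hq)).isSymmSndFDerivAt (by simp)
  obtain ⟨α, hα, hle⟩ := exists_pos_mul_norm_sq_le_of_injective hsymm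
    (fderiv_fderiv_nonneg_of_subgradient hB hsub hu hq) hker
  have hD : fderivWithin ℝ (fderivWithin ℝ a.indirectUtility B) B q =
      fderiv ℝ (fderiv ℝ a.indirectUtility) q := by
    rw [fderivWithin_of_isOpen hB hq]
    refine Filter.EventuallyEq.fderiv_eq ?_
    filter_upwards [hB.mem_nhds hq] with r hr using fderivWithin_of_isOpen hB hr
  refine ⟨q, hq, ?_⟩
  rw [← stronglyConvexAt_inter_open_iff hB hq, inter_eq_self_of_subset_right hBP]
  exact stronglyConvexAt_of_mul_norm_sq_le hB.uniqueDiffOn hq (by rwa [hD]) hα (by rwa [hD])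

end Allocation

/-! ### The bunching criterion. -/

theorem lemma2 (P : Set TaskVec) (a : Allocation) (ha : a.IncentiveCompatible P)
    (p : TaskVec) (hp : p ∈ P)
    (hP : p ∈ interior P ∨ (Convex ℝ P ∧ (interior P).Nonempty))
    (hu : ContDiffWithinAt ℝ 2 a.indirectUtility P p) :
    (StronglyConvexAt a.indirectUtility P p →
      p ∉ a.bunchingSet P ∧ ∃ N ∈ 𝓝 p, Set.InjOn a.x (N ∩ P)) ∧
    ((∃ N ∈ 𝓝 p, ∀ q ∈ N ∩ P, ¬ StronglyConvexAt a.indirectUtility P q) →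
      p ∈ a.bunchingSet P) ∧
    ((∃ N ∈ 𝓝 p, ∀ q ∈ N ∩ P, (hessianMatrix a.indirectUtility P q).det = 0) →
      p ∈ a.bunchingSet P) := by
  set u := a.indirectUtility
  obtain ⟨ρ, hρ, hconv, hcd, hcl⟩ := exists_ball_inter_convex_contDiffOn hp hP hu
  set U := Metric.ball p ρ
  have hUo : IsOpen U := Metric.isOpen_ball
  have hpU : p ∈ U := Metric.mem_ball_self hρ
  have hbunch : (∃ N ∈ 𝓝 p, ∀ q ∈ N ∩ P, ¬ StronglyConvexAt u P q) → p ∈ a.bunchingSet P := by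
    rintro ⟨N, hN, hnot⟩
    refine ⟨hp, fun M hM => ?_⟩
    obtain ⟨V, hVsub, hVo, hpV⟩ := mem_nhds_iff.1
      (Filter.inter_mem (Filter.inter_mem hN hM) (hUo.mem_nhds hpU))
    have hne : (V ∩ interior P).Nonempty := mem_closure_iff.1 hcl V hVo hpV
    -- Bunching asks for two workers other than `p`, so `p` is removed; what remains is nonempty
    -- because `{p}` is not open.
    set B := (V ∩ interior P) \ {p} with hBdef
    have hBo : IsOpen B := (hVo.inter isOpen_interior).sdiff isClosed_singleton
    have hBne : B.Nonempty := by
      by_contra hemp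
      rw [not_nonempty_iff_eq_empty, hBdef, sdiff_eq_empty] at hemp
      have heq := (hne.subset_singleton_iff.1 hemp)
      exact not_isOpen_singleton p (heq ▸ hVo.inter isOpen_interior)
    have hBP : B ⊆ P := fun q hq => interior_subset hq.1.2
    have hBV : ∀ q ∈ B, (q ∈ N ∧ q ∈ M) ∧ q ∈ U := fun q hq => hVsub hq.1.1
    have hninj : ¬ InjOn a.x B := fun hinj => by
      obtain ⟨q, hq, hsc⟩ := ha.exists_stronglyConvexAt_of_injOn hBo hBne hBP
        (hcd.mono fun q hq => ⟨hBP hq, (hBV q hq).2⟩) hinj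
      exact hnot q ⟨(hBV q hq).1.1, hBP hq⟩ hsc
    simp only [InjOn, not_forall] at hninj
    obtain ⟨p', hp', p'', hp'', hx, hne'⟩ := hninj
    exact ⟨p', ⟨(hBV p' hp').1.2, hBP hp'⟩, p'', ⟨(hBV p'' hp'').1.2, hBP hp''⟩,
      hp'.2, hp''.2, hne', hx⟩
  refine ⟨fun hsc => ?_, hbunch, ?_⟩
  -- Convexity with nonempty interior makes derivatives within `P ∩ U` unique, even at boundary
  -- points.
  · have hint : (interior (P ∩ U)).Nonempty := by
      rw [interior_inter, hUo.interior_eq, inter_comm]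
      exact mem_closure_iff.1 hcl U hUo hpU
    have hud : UniqueDiffOn ℝ (P ∩ U) := uniqueDiffOn_convex hconv hint
    obtain ⟨α, hα, hle⟩ := ((stronglyConvexAt_inter_open_iff hUo hpU).2
      hsc).exists_pos_mul_norm_sq_le hud ⟨hp, hpU⟩
    have hev := eventually_fderivWithin_fderivWithin_pos hud hcd ⟨hp, hpU⟩ hα hle
    obtain ⟨σ, hσ, hσsub⟩ := Metric.mem_nhdsWithin_iff.1 hev
    set S := Metric.ball p σ ∩ (P ∩ U)
    have hstrict : StrictConvexOn ℝ S u :=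
      strictConvexOn_of_fderivWithin_fderivWithin_pos hud hcd
        ((convex_ball p σ).inter hconv) inter_subset_right fun q hq => hσsub hq
    have hinj : InjOn a.x S := ha.injOn_of_strictConvexOn (fun q hq => hq.2.1) hstrict
    have hN : Metric.ball p σ ∩ U ∈ 𝓝 p :=
      Filter.inter_mem (Metric.ball_mem_nhds p hσ) (hUo.mem_nhds hpU)
    have hinj' : InjOn a.x (Metric.ball p σ ∩ U ∩ P) :=
      fun q hq r hr => hinj ⟨hq.1.1, hq.2, hq.1.2⟩ ⟨hr.1.1, hr.2, hr.1.2⟩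
    exact ⟨Allocation.not_mem_bunchingSet_of_injOn hN hinj',
      Metric.ball p σ ∩ U, hN, hinj'⟩
  · rintro ⟨N, hN, hdet⟩
    exact hbunch ⟨N, hN, fun q hq hsc => hsc.det_hessianMatrix_pos.ne' (hdet q hq)⟩
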